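/- Write $\log(x)=\ln(\max(x,e))$ for the truncated logarithm. Let $\mathcal F$ be a class of functions $\mathcal X\to\{1,-1\}$. For points $x_1,\dots,x_n\in\mathcal X$ (repetitions allowed) put $\rho_H(f,g)=|\{i: f(x_i)\ne g(x_i)\}|$ and $\mathcal B_H(f,r,\{x_1,\dots,x_n\})=\{g\in\mathcal F:\rho_H(f,g)\le r\}$, and let $\mathcal M_1(\mathcal H,\varepsilon)$ be the largest number of elements of $\mathcal H$ with pairwise $\rho_H$-distances greater than $\varepsilon$. For $h,h'\in(0,1]$ and $\gamma\ge 0$ define $$\mathcal M^{\mathrm{loc}}_1(\mathcal F,\gamma,n,h)=\max_{x_1,\dots,x_n\in\mathcal X}\ \max_{f\in\mathcal F}\ \max_{\varepsilon\ge\gamma}\ \mathcal M_1\bigl(\mathcal B_H(f,\varepsilon/h,\{x_1,\dots,x_n\}),\varepsilon/2\bigr),$$ $$\gamma^{\mathrm{loc}}_{h,h'}(n,\mathcal F)=\max\{\gamma\in\mathbb N:\ h\gamma\le\log \mathcal M^{\mathrm{loc}}_1(\mathcal F,\gamma,n,h')\}.$$ Proposition. For $d\ge 2$ let $\mathcal F_d$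 be the class of linear separators in $\mathbb R^d$, i.e. of the functions $x\mapsto \operatorname{sign}(\langle w,x\rangle+b)$ with $w\in\mathbb R^d$, $b\in\mathbb R$ and $\operatorname{sign}(0)=1$. There are universal constants $c,C>0$ such that for all integers $d\ge 2$ and $n\ge 1$ and all real $h$ with $\sqrt{d/n}<h\le 1$, $$c\,\frac{d\log\left(\frac{nh^2}{d}\right)}{h}\ \le\ \gamma^{\mathrm{loc}}_{h,h}(n,\mathcal F_d)\ \le\ C\,\frac{d\log\left(\frac{nh}{d}\right)}{h}.$$ In particular, there are universal constants $c,C>0$ such that $c\,d\log(n/d)\le\gamma^{\mathrm{loc}}_{1,1}(n,\mathcal F_d)\le C\,d\log(n/d)$ for all integers $d\ge 2$ and $n>d$. -/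

import Mathlib

open scoped NNReal

noncomputable section

/-- The truncated logarithm `ln (max x e)`. -/
def truncLog (x : ℝ) : ℝ := Real.log (max x (Real.exp 1))

/-- `B_H(f, r, {x₁, …, xₙ})`: the classifiers `g ∈ F` that disagree with `f` on at most `r` of the
sample points. The label space `{1, -1}` is `ℤˣ`, and `hammingDist (f ∘ x) (g ∘ x)` is the number
of indices `i` with `f (x i) ≠ g (x i)`. -/
def empiricalBall {X : Type*} {n : ℕ} (F : Set (X → ℤˣ)) (f : X → ℤˣ) (r : ℝ) (x : Fin n → X) :
    Set (X → ℤˣ) :=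
  {g | g ∈ F ∧ (hammingDist (f ∘ x) (g ∘ x) : ℝ) ≤ r}

/-- The projections of the classifiers in `S` on the sample `x₁, …, xₙ`, as a subset of the space
of sign vectors of length `n` with the Hamming metric. -/
def sampleProjection {X : Type*} {n : ℕ} (S : Set (X → ℤˣ)) (x : Fin n → X) :
    Set (Hamming fun _ : Fin n => ℤˣ) :=
  (fun g : X → ℤˣ => Hamming.toHamming (g ∘ x)) '' S

/-- The worst-case local empirical packing number: the supremum over samples `x₁, …, xₙ`, centres
`f ∈ F` and scales `ε ≥ γ` of the largest number of elements of the ball of radius `ε / h` about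
`f` whose pairwise Hamming distances on the sample exceed `ε / 2`. -/
def localPackingNumber {X : Type*} (F : Set (X → ℤˣ)) (γ : ℝ) (n : ℕ) (h : ℝ) : ℕ∞ :=
  ⨆ (x : Fin n → X) (f ∈ F) (ε : ℝ≥0) (_ : γ ≤ ε),
    Metric.packingNumber (ε / 2) (sampleProjection (empiricalBall F f (ε / h) x) x)

/-- The `γ ∈ ℕ` with `h γ ≤ log M(γ)`, where `M(γ)` is the worst-case local empirical packing
number (a finite number, see `localPackingNumber_le`). -/
def localEntropySet {X : Type*} (F : Set (X → ℤˣ)) (h h' : ℝ) (n : ℕ) : Set ℕ :=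
  {γ | h * (γ : ℝ) ≤ truncLog ((localPackingNumber F γ n h').toNat : ℝ)}

/-- The fixed point of the local empirical entropy: the largest element of `localEntropySet`
(see `isGreatest_gammaLoc`). -/
def gammaLoc {X : Type*} (F : Set (X → ℤˣ)) (h h' : ℝ) (n : ℕ) : ℕ :=
  sSup (localEntropySet F h h' n)

/-- The class of linear separators of `ℝ^d`: all `x ↦ sign (⟨w, x⟩ + b)`, with value `1` on the
hyperplane itself. -/
def linearSeparators (d : ℕ) : Set (EuclideanSpace ℝ (Fin d) → ℤˣ) :=
  {f | ∃ (w : EuclideanSpace ℝ (Fin d)) (b : ℝ), ∀ x, f x = if 0 ≤ inner ℝ w x + b then 1 else -1}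

theorem localPackingNumber_le {X : Type*} (F : Set (X → ℤˣ)) (γ : ℝ) (n : ℕ) (h : ℝ) :
    localPackingNumber F γ n h ≤ ((2 ^ n : ℕ) : ℕ∞) := by
  have key : ∀ C : Set (Hamming fun _ : Fin n => ℤˣ), C.encard ≤ ((2 ^ n : ℕ) : ℕ∞) := by
    intro C
    refine (Set.encard_le_encard (Set.subset_univ C)).trans ?_
    have : (Set.univ : Set (Fin n → ℤˣ)).encard = ((2 ^ n : ℕ) : ℕ∞) := by
      rw [Set.encard_univ, ENat.card_eq_coe_fintype_card]
      simp
    exact this.le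
  refine iSup_le fun x => iSup_le fun f => iSup_le fun _ => iSup_le fun ε => iSup_le fun _ => ?_
  exact iSup_le fun C => iSup_le fun _ => iSup_le fun _ => key C

theorem isGreatest_gammaLoc {X : Type*} (F : Set (X → ℤˣ)) {h : ℝ} (hh : 0 < h) (h' : ℝ) (n : ℕ) :
    IsGreatest (localEntropySet F h h' n) (gammaLoc F h h' n) := by
  have hne : (localEntropySet F h h' n).Nonempty := by
    refine ⟨0, ?_⟩
    simp only [localEntropySet, Set.mem_ofPred_eq, Nat.cast_zero, mul_zero, truncLog]
    exact Real.log_nonneg (le_max_of_le_right (Real.one_le_exp zero_le_one))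
  have hbdd : BddAbove (localEntropySet F h h' n) := by
    refine ⟨⌊truncLog ((2 ^ n : ℕ) : ℝ) / h⌋₊, fun γ hγ => Nat.le_floor ?_⟩
    rw [le_div_iff₀ hh, mul_comm]
    refine le_trans hγ ?_
    have h1 : (localPackingNumber F γ n h').toNat ≤ 2 ^ n :=
      ENat.toNat_le_of_le_natCast (localPackingNumber_le F γ n h')
    have h2 : ((localPackingNumber F γ n h').toNat : ℝ) ≤ ((2 ^ n : ℕ) : ℝ) := by exact_mod_cast h1
    exact Real.log_le_log (lt_max_of_lt_right (Real.exp_pos 1)) (max_le_max_right _ h2)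
  exact ⟨Nat.sSup_mem hne hbdd, fun γ hγ => le_csSup hbdd hγ⟩

end

/-! Upper bound: half-spaces have VC dimension at most d + 1 (Radon), and the packing bound
`log_card_le_of_separated` gives log M(γ) ≤ 2(d + 1) log(16n/γ), even without using the
localization. If hγ exceeded 16 d log(nh/d), then 16n/γ ≤ nh/d, and the fixed-point inequality would
give hγ ≤ 4 d log(nh/d), a contradiction.

Lower bound: on the moment curve, any d/2 of finitely many nodes can be cut off by a half-space.
Place s·q nodes there with s of order d, repeat each k ≈ n/(sq) times, and let a code in `Fin s →
Fin q` select s nodes per codeword. The resulting separators lie within sk of the all-negative one,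
are more than sk/2 apart, and have log-cardinality at least (s/4) log q (`exists_code_log_card`,
`card_le_localPackingNumber`). With u = nh²/d and q of order √u, both this entropy and h·ε for ε =
hsk are at least of order d log u. -/

/-! ### VC dimension of half-spaces and Sauer–Shelah. -/

/-- `Shattered F y S` says that every labelling of the points `y i`, `i ∈ S`, is realized by `F`. -/
def Shattered {X ι : Type*} (F : Set (X → ℤˣ)) (y : ι → X) (S : Finset ι) : Prop :=
  ∀ T ⊆ S, ∃ f ∈ F, ∀ i ∈ S, f (y i) = 1 ↔ i ∈ T

/-- For d + 2 points, a Radon point would lie both in the closed half-space of the positive labels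
and in its open complement, since both are convex. -/
theorem card_le_of_shattered_linearSeparators {ι : Type*} {d : ℕ}
    {y : ι → EuclideanSpace ℝ (Fin d)} {S : Finset ι}
    (hS : Shattered (linearSeparators d) y S) : S.card ≤ d + 1 := by
  classical
  by_contra hcard
  have hdep : ¬ AffineIndependent ℝ (fun i : S => y i) := by
    intro h
    have h1 := h.card_le_finrank_succ
    have h2 := Submodule.finrank_le (vectorSpan ℝ (Set.range fun i : S => y i))
    rw [finrank_euclideanSpace_fin] at h2
    rw [Fintype.card_coe] at h1
    omega
  obtain ⟨I, z, hz1, hz2⟩ := Convex.radon_partition hdep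
  obtain ⟨f, ⟨w, b, hf⟩, hfS⟩ := hS (S.filter fun i => ∃ h : i ∈ S, (⟨i, h⟩ : S) ∈ I)
    (Finset.filter_subset _ _)
  have hlab : ∀ i : S, 0 ≤ inner ℝ w (y i) + b ↔ i ∈ I := by
    intro i
    have h1 := hfS i i.2
    rw [hf] at h1
    have h2 : (if 0 ≤ inner ℝ w (y i) + b then (1 : ℤˣ) else -1) = 1
        ↔ 0 ≤ inner ℝ w (y i) + b := by
      split_ifs with h <;> simp [h]
    rw [h2] at h1
    rw [h1]
    simp
  have hlin : IsLinearMap ℝ (fun x : EuclideanSpace ℝ (Fin d) => inner ℝ w x) :=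
    (innerₗ (EuclideanSpace ℝ (Fin d)) w).isLinear
  have hpos : z ∈ {x | -b ≤ inner ℝ w x} := by
    refine convexHull_min ?_ (convex_halfSpace_ge hlin (-b)) hz1
    rintro _ ⟨i, hi, rfl⟩
    have := (hlab i).2 hi
    simp only [Set.mem_ofPred_eq]
    linarith
  have hneg : z ∈ {x | inner ℝ w x < -b} := by
    refine convexHull_min ?_ (convex_halfSpace_lt hlin (-b)) hz2
    rintro _ ⟨i, hi, rfl⟩
    have := fun h => hi ((hlab i).1 h)
    simp only [Set.mem_ofPred_eq]
    linarith [not_le.1 this]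
  simp only [Set.mem_ofPred_eq] at hpos hneg
  linarith

/-- The Sauer–Shelah bound for the restriction of `F` to a finite family of points. -/
theorem card_le_sum_choose_of_shattered {X ι κ : Type*} [Fintype κ] {F : Set (X → ℤˣ)} {V : ℕ}
    {x : ι → X} (hV : ∀ (y : κ → X) (S : Finset κ), Shattered F y S → S.card ≤ V)
    (C : Finset (ι → ℤˣ)) (hC : ∀ c ∈ C, ∃ f ∈ F, f ∘ x = c) (σ : κ → ι)
    (hσ : Set.InjOn (fun c : ι → ℤˣ => c ∘ σ) C) :
    C.card ≤ ∑ i ∈ Finset.Iic V, (Fintype.card κ).choose i := by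
  classical
  set tr : (ι → ℤˣ) → Finset κ := fun c => Finset.univ.filter fun i => c (σ i) = 1 with htr
  have hinj : Set.InjOn tr C := by
    intro c hc c' hc' h
    refine hσ hc hc' (funext fun i => ?_)
    have hi : c (σ i) = 1 ↔ c' (σ i) = 1 := by simpa [htr] using Finset.ext_iff.1 h i
    rcases Int.units_eq_one_or (c (σ i)) with h1 | h1 <;>
      rcases Int.units_eq_one_or (c' (σ i)) with h2 | h2 <;> simp_all
  rw [← Finset.card_image_of_injOn hinj]
  refine (Finset.card_le_card_shatterer _).trans
    (Finset.card_shatterer_le_sum_vcDim.trans (Finset.sum_le_sum_of_subset ?_))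
  refine Finset.Iic_subset_Iic.2 (Finset.sup_le fun S hS => ?_)
  refine hV (x ∘ σ) S fun T hT => ?_
  obtain ⟨u, hu, huT⟩ := Finset.mem_shatterer.1 hS hT
  obtain ⟨c, hc, rfl⟩ := Finset.mem_image.1 hu
  obtain ⟨f, hf, rfl⟩ := hC c hc
  refine ⟨f, hf, fun i hi => ?_⟩
  rw [← huT]
  simp [htr, hi]

/-- Weighting by l ^ (i - V) ≥ 1 completes the sum to (1 + l) ^ m ≤ exp (l m). Keeping `l` free lets
the exponential be absorbed later. -/
theorem sum_choose_le_rpow {m V : ℕ} {l : ℝ} (hl : 0 < l) (hl1 : l ≤ 1) :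
    (∑ i ∈ Finset.Iic V, (m.choose i : ℝ)) ≤ (l⁻¹) ^ V * Real.exp (l * m) := by
  have h1 : ∑ i ∈ Finset.Iic V, (m.choose i : ℝ)
      ≤ ∑ i ∈ Finset.Iic V, (l⁻¹) ^ V * (l ^ i * m.choose i) := by
    refine Finset.sum_le_sum fun i hi => ?_
    have hi' : i ≤ V := Finset.mem_Iic.1 hi
    have : 1 ≤ (l⁻¹) ^ V * l ^ i := by
      rw [← Nat.sub_add_cancel hi', pow_add, mul_assoc, ← mul_pow, inv_mul_cancel₀ hl.ne', one_pow,
        mul_one]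
      exact one_le_pow₀ ((one_le_inv₀ hl).2 hl1)
    rw [← mul_assoc]
    exact le_mul_of_one_le_left (Nat.cast_nonneg _) this
  refine h1.trans ?_
  rw [← Finset.mul_sum]
  refine mul_le_mul_of_nonneg_left ?_ (by positivity)
  have h2 : ∑ i ∈ Finset.Iic V, l ^ i * (m.choose i : ℝ)
      ≤ ∑ i ∈ Finset.range (m + 1), l ^ i * (m.choose i : ℝ) := by
    rw [← Finset.sum_filter_add_sum_filter_not (Finset.Iic V) (fun i => i ≤ m)]
    have h0 : ∑ i ∈ Finset.Iic V with ¬ i ≤ m, l ^ i * (m.choose i : ℝ) = 0 := by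
      refine Finset.sum_eq_zero fun i hi => ?_
      rw [Nat.choose_eq_zero_of_lt (not_le.1 (Finset.mem_filter.1 hi).2)]
      simp
    rw [h0, add_zero]
    refine Finset.sum_le_sum_of_subset_of_nonneg (fun i hi => ?_) fun _ _ _ => by positivity
    exact Finset.mem_range.2 (Nat.lt_succ_of_le (Finset.mem_filter.1 hi).2)
  refine h2.trans ?_
  have h3 : ∑ i ∈ Finset.range (m + 1), l ^ i * (m.choose i : ℝ) = (l + 1) ^ m := by
    rw [add_pow]; simp
  rw [h3, mul_comm, Real.exp_nat_mul]
  exact pow_le_pow_left₀ (by positivity) (Real.add_one_le_exp l) m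

/-! ### Packing numbers of VC classes. -/

/-- A separated set of sign vectors stays distinct on some sample of `m` coordinates. -/
theorem exists_injOn_comp_of_separated {n m : ℕ} (hn : 0 < n) (C : Finset (Fin n → ℤˣ)) {δ : ℝ}
    (hδn : δ ≤ n)
    (hsep : ∀ c ∈ C, ∀ c' ∈ C, c ≠ c' → δ ≤ hammingDist c c')
    (hm : (C.card : ℝ) ^ 2 * Real.exp (-(δ / n * m)) < 1) :
    ∃ σ : Fin m → Fin n, Set.InjOn (fun c : Fin n → ℤˣ => c ∘ σ) C := by
  classical
  by_contra! hno
  -- Union bound by counting: if every sample fails, each σ takes values in the agreement set of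
  -- some pair, which has at most n - δ elements.
  have hcover : (Finset.univ : Finset (Fin m → Fin n)) ⊆
      C.offDiag.biUnion fun p =>
        Fintype.piFinset fun _ => Finset.univ.filter fun i => p.1 i = p.2 i := by
    intro σ _
    have h := hno σ
    simp only [Set.InjOn, not_forall] at h
    obtain ⟨c, hc, c', hc', heq, hne⟩ := h
    refine Finset.mem_biUnion.2 ⟨(c, c'), Finset.mem_offDiag.2 ⟨hc, hc', hne⟩, ?_⟩
    simp only [Fintype.mem_piFinset, Finset.mem_filter, Finset.mem_univ, true_and]
    exact fun j => congrFun heq j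
  have hcard := (Finset.card_le_card hcover).trans Finset.card_biUnion_le
  have hn' : (0 : ℝ) < n := Nat.cast_pos.2 hn
  have hagree : ∀ p ∈ C.offDiag,
      ((Fintype.piFinset fun _ : Fin m =>
        Finset.univ.filter fun i => p.1 i = p.2 i).card : ℝ) ≤ (n - δ) ^ m := by
    intro p hp
    obtain ⟨h1, h2, hne⟩ := Finset.mem_offDiag.1 hp
    have hd := hsep _ h1 _ h2 hne
    have hsum := Finset.card_filter_add_card_filter_not (s := (Finset.univ : Finset (Fin n)))
      (fun i => p.1 i = p.2 i)
    have hham : (Finset.univ.filter fun i => ¬ p.1 i = p.2 i).card = hammingDist p.1 p.2 := rfl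
    rw [hham, Finset.card_univ, Fintype.card_fin] at hsum
    have hsum' : ((Finset.univ.filter fun i => p.1 i = p.2 i).card : ℝ) + hammingDist p.1 p.2 = n := by
      exact_mod_cast hsum
    rw [Fintype.card_piFinset_const]
    push_cast
    exact pow_le_pow_left₀ (by positivity) (by linarith) _
  have hcard' : (n : ℝ) ^ m ≤ (C.card : ℝ) ^ 2 * (n - δ) ^ m := by
    have h1 : (n : ℝ) ^ m ≤ ∑ p ∈ C.offDiag, (n - δ) ^ m := by
      refine le_trans ?_ (Finset.sum_le_sum hagree)
      have : n ^ m ≤ ∑ p ∈ C.offDiag, (Fintype.piFinset fun _ : Fin m =>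
        Finset.univ.filter fun i => p.1 i = p.2 i).card := by simpa using hcard
      exact_mod_cast this
    rw [Finset.sum_const, nsmul_eq_mul] at h1
    refine h1.trans (mul_le_mul_of_nonneg_right ?_ (pow_nonneg (by linarith) _))
    rw [Finset.offDiag_card, sq]
    exact_mod_cast Nat.sub_le _ _
  have hexp : ((n : ℝ) - δ) ^ m ≤ (n : ℝ) ^ m * Real.exp (-(δ / n * m)) := by
    have h1 : (n : ℝ) - δ ≤ n * Real.exp (-(δ / n)) := by
      have := Real.add_one_le_exp (-(δ / n))
      calc (n : ℝ) - δ = n * (-(δ / n) + 1) := by field_simp; ring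
        _ ≤ _ := mul_le_mul_of_nonneg_left this hn'.le
    calc ((n : ℝ) - δ) ^ m ≤ (n * Real.exp (-(δ / n))) ^ m :=
          pow_le_pow_left₀ (by linarith) h1 _
      _ = _ := by rw [mul_pow, ← Real.exp_nat_mul]; congr 2; ring
  have hpos : (0 : ℝ) < (n : ℝ) ^ m := by positivity
  have : (n : ℝ) ^ m ≤ (n : ℝ) ^ m * ((C.card : ℝ) ^ 2 * Real.exp (-(δ / n * m))) := by
    calc (n : ℝ) ^ m ≤ (C.card : ℝ) ^ 2 * (n - δ) ^ m := hcard'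
      _ ≤ (C.card : ℝ) ^ 2 * ((n : ℝ) ^ m * Real.exp (-(δ / n * m))) :=
        mul_le_mul_of_nonneg_left hexp (by positivity)
      _ = _ := by ring
  nlinarith

/-- The packing bound for a class of VC dimension at most `V`. -/
theorem log_card_le_of_separated {X : Type*} {F : Set (X → ℤˣ)} {V n : ℕ} (hV1 : 1 ≤ V)
    (hV : ∀ (m : ℕ) (y : Fin m → X) (S : Finset (Fin m)), Shattered F y S → S.card ≤ V)
    {x : Fin n → X} (C : Finset (Fin n → ℤˣ)) (hC : ∀ c ∈ C, ∃ f ∈ F, f ∘ x = c)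
    (hcard : 2 ≤ C.card) {δ : ℝ} (hδ : 0 < δ)
    (hsep : ∀ c ∈ C, ∀ c' ∈ C, c ≠ c' → δ ≤ hammingDist c c') :
    Real.log C.card ≤ 2 * V * Real.log (8 * n / δ) := by
  have hδn : δ ≤ n := by
    obtain ⟨c, hc, c', hc', hne⟩ := Finset.one_lt_card.1 hcard
    refine (hsep c hc c' hc' hne).trans ?_
    have := hammingDist_le_card_fintype (x := c) (y := c')
    rw [Fintype.card_fin] at this
    exact_mod_cast this
  have hn' : (0 : ℝ) < n := hδ.trans_le hδn
  have hn : 0 < n := Nat.cast_pos.1 hn'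
  set N : ℝ := (C.card : ℝ) with hN
  have hNpos : 0 < N := by rw [hN]; exact_mod_cast (by omega : 0 < C.card)
  have hN1 : 1 ≤ N := by rw [hN]; exact_mod_cast (by omega : 1 ≤ C.card)
  have hlogN : 0 ≤ Real.log N := Real.log_nonneg hN1
  -- The least integer that makes the union bound over N² pairs strict.
  set m : ℕ := ⌊2 * Real.log N * (n / δ)⌋₊ + 1 with hm
  have hm1 : 2 * Real.log N * (n / δ) < m := by
    rw [hm]; push_cast; exact Nat.lt_floor_add_one _
  have hm2 : (m : ℝ) ≤ 2 * Real.log N * (n / δ) + 1 := by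
    rw [hm]; push_cast
    linarith [Nat.floor_le (show 0 ≤ 2 * Real.log N * (n / δ) by positivity)]
  have hmm : N ^ 2 * Real.exp (-(δ / n * m)) < 1 := by
    have h1 : 2 * Real.log N < δ / n * m := by
      have := mul_lt_mul_of_pos_left hm1 (show 0 < δ / n by positivity)
      calc 2 * Real.log N = δ / n * (2 * Real.log N * (n / δ)) := by field_simp
        _ < _ := this
    have h2 : N ^ 2 = Real.exp (2 * Real.log N) := by
      rw [two_mul, Real.exp_add, Real.exp_log hNpos, sq]
    rw [h2, ← Real.exp_add, Real.exp_lt_one_iff]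
    linarith
  obtain ⟨σ, hσ⟩ := exists_injOn_comp_of_separated hn C hδn hsep hmm
  have h1 := card_le_sum_choose_of_shattered (hV m) C hC σ hσ
  rw [Fintype.card_fin] at h1
  -- With this `l`, the term l·m is at most log N / 4 + 1/8 and moves to the left side, so no
  -- iterated logarithm appears.
  set l : ℝ := δ / (8 * n) with hl
  have hlpos : 0 < l := by positivity
  have hl8 : l ≤ 1 / 8 := by
    rw [hl, div_le_div_iff₀ (by positivity) (by norm_num)]; linarith
  have h2 : N ≤ (l⁻¹) ^ V * Real.exp (l * m) := by
    refine le_trans ?_ (sum_choose_le_rpow hlpos (by linarith))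
    rw [hN]; exact_mod_cast h1
  have hlinv : l⁻¹ = 8 * n / δ := by rw [hl, inv_div]
  have h3 := Real.log_le_log hNpos h2
  rw [Real.log_mul (by positivity) (by positivity), Real.log_pow, Real.log_exp, hlinv] at h3
  have h4 : l * m ≤ Real.log N / 4 + 1 / 8 := by
    have h5 := mul_le_mul_of_nonneg_left hm2 hlpos.le
    have h6 : l * (2 * Real.log N * (n / δ) + 1) = Real.log N / 4 + l := by
      rw [hl]; field_simp; ring
    linarith
  have h7 : 1 ≤ Real.log (8 * n / δ) := by
    rw [Real.le_log_iff_exp_le (by positivity), le_div_iff₀ hδ]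
    nlinarith [Real.exp_one_lt_d9]
  have h8 : (1 : ℝ) ≤ V := by exact_mod_cast hV1
  nlinarith

theorem hamming_edist_eq {n : ℕ} (a b : Hamming fun _ : Fin n => ℤˣ) :
    edist a b = ((hammingDist (Hamming.ofHamming a) (Hamming.ofHamming b) : ℝ≥0) : ENNReal) := by
  rw [edist_nndist, Hamming.nndist_eq_hammingDist]

/-- Only the separation ε/2 ≥ γ/2 matters here; membership in the ball is discarded. The `max 0`
covers packings with at most one element, for which the logarithm may be negative. -/
theorem localPackingNumber_le_of_shattered {X : Type*} {F : Set (X → ℤˣ)} {V : ℕ} (hV1 : 1 ≤ V)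
    (hV : ∀ (m : ℕ) (y : Fin m → X) (S : Finset (Fin m)), Shattered F y S → S.card ≤ V)
    {γ : ℝ} (hγ : 0 < γ) (n : ℕ) (h : ℝ) :
    localPackingNumber F γ n h
      ≤ (⌊Real.exp (max 0 (2 * V * Real.log (16 * n / γ)))⌋₊ : ℕ∞) := by
  classical
  refine iSup_le fun x => iSup_le fun f => iSup_le fun _ => iSup_le fun ε => iSup_le fun hε =>
    iSup_le fun C => iSup_le fun hC => iSup_le fun hsep => ?_
  have hfin : C.Finite := by
    have : Finite (Hamming fun _ : Fin n => ℤˣ) := inferInstanceAs (Finite (Fin n → ℤˣ))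
    exact Set.toFinite C
  obtain ⟨D, rfl⟩ : ∃ D : Finset (Fin n → ℤˣ), C = Hamming.toHamming '' (D : Set (Fin n → ℤˣ)) := by
    refine ⟨(hfin.image Hamming.ofHamming).toFinset, ?_⟩
    ext a
    simp
  rw [Hamming.toHamming.injective.encard_image, Set.encard_coe_eq_coe_finsetCard]
  refine Nat.cast_le.2 (Nat.le_floor ?_)
  rcases Nat.lt_or_ge D.card 2 with h2 | h2
  · have : (D.card : ℝ) ≤ 1 := by exact_mod_cast (by omega : D.card ≤ 1)
    exact this.trans (Real.one_le_exp (le_max_left _ _))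
  · have hlog := log_card_le_of_separated hV1 hV (x := x) D (fun c hc => ?_) h2
      (half_pos hγ) (fun c hc c' hc' hne => ?_)
    · rw [← Real.log_le_iff_le_exp (by exact_mod_cast (by omega : 0 < D.card))]
      refine (hlog.trans_eq ?_).trans (le_max_right _ _)
      congr 2
      field_simp
      ring
    · obtain ⟨g, hg, hgc⟩ := hC (Set.mem_image_of_mem _ hc)
      exact ⟨g, hg.1, Hamming.toHamming.injective hgc⟩
    · have h3 := hsep (Set.mem_image_of_mem _ hc) (Set.mem_image_of_mem _ hc')
        (fun h => hne (Hamming.toHamming.injective h))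
      beta_reduce at h3
      rw [hamming_edist_eq] at h3
      have h4 : ε / 2 < (hammingDist c c' : ℝ≥0) := by exact_mod_cast h3
      have h5 : (ε : ℝ) / 2 < hammingDist c c' := by exact_mod_cast h4
      linarith

/-! ### Truncated logarithm and the upper bound. -/

theorem le_gammaLoc {X : Type*} (F : Set (X → ℤˣ)) {h : ℝ} (hh : 0 < h) {h' : ℝ} {n γ : ℕ}
    (hγ : h * γ ≤ truncLog ((localPackingNumber F γ n h').toNat : ℝ)) : γ ≤ gammaLoc F h h' n :=
  (isGreatest_gammaLoc F hh h' n).2 hγ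

theorem one_le_truncLog (x : ℝ) : 1 ≤ truncLog x := by
  rw [truncLog, Real.le_log_iff_exp_le (lt_max_of_lt_right (Real.exp_pos 1))]
  exact le_max_right _ _

theorem log_le_truncLog {x : ℝ} (hx : 0 < x) : Real.log x ≤ truncLog x :=
  Real.log_le_log hx (le_max_left _ _)

theorem truncLog_mono {x y : ℝ} (hxy : x ≤ y) : truncLog x ≤ truncLog y :=
  Real.log_le_log (lt_max_of_lt_right (Real.exp_pos 1)) (max_le_max_right _ hxy)

theorem truncLog_exp_le {t : ℝ} : truncLog (Real.exp t) ≤ max 1 t := by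
  rw [truncLog, ← Real.exp_monotone.map_max, Real.log_exp, max_comm]

theorem gammaLoc_linearSeparators_le {d n : ℕ} {h : ℝ} (hd : 2 ≤ d) (hn : 1 ≤ n) (hh : 0 < h) :
    (gammaLoc (linearSeparators d) h h n : ℝ)
      ≤ 16 * ((d : ℝ) * truncLog ((n : ℝ) * h / (d : ℝ)) / h) := by
  set γ := gammaLoc (linearSeparators d) h h n with hγdef
  set L := truncLog ((n : ℝ) * h / (d : ℝ)) with hL
  have hL1 : 1 ≤ L := one_le_truncLog _
  have hd2 : (2 : ℝ) ≤ d := by exact_mod_cast hd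
  have hn0 : (0 : ℝ) < n := by exact_mod_cast hn
  have hmem : h * γ ≤ truncLog ((localPackingNumber (linearSeparators d) γ n h).toNat : ℝ) :=
    (isGreatest_gammaLoc (linearSeparators d) hh h n).1
  by_contra! hlt
  rw [← mul_div_assoc, div_lt_iff₀ hh, mul_comm (γ : ℝ)] at hlt
  have hγpos : (0 : ℝ) < γ := by
    by_contra! h0
    nlinarith [mul_nonneg hh.le (Nat.cast_nonneg γ : (0 : ℝ) ≤ γ)]
  have hpack := localPackingNumber_le_of_shattered (F := linearSeparators d) (V := d + 1) (by omega)
    (fun m y S hS => card_le_of_shattered_linearSeparators hS) hγpos n h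
  have h1 : ((localPackingNumber (linearSeparators d) γ n h).toNat : ℝ)
      ≤ Real.exp (max 0 (2 * (d + 1 : ℕ) * Real.log (16 * n / γ))) :=
    (Nat.le_floor_iff (Real.exp_pos _).le).1 (ENat.toNat_le_of_le_natCast hpack)
  have h2 := (hmem.trans (truncLog_mono h1)).trans truncLog_exp_le
  -- The contrary assumption gives hγ ≥ 16d, that is 16n/γ ≤ nh/d.
  have h3 : Real.log (16 * n / γ) ≤ L := by
    refine le_trans (Real.log_le_log (by positivity) ?_) (log_le_truncLog (by positivity))
    rw [div_le_div_iff₀ hγpos (by positivity)]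
    have : 16 * (d : ℝ) ≤ h * γ := by nlinarith
    nlinarith
  have h4 : 2 * ((d + 1 : ℕ) : ℝ) * Real.log (16 * n / γ) ≤ 4 * d * L := by
    push_cast
    calc 2 * ((d : ℝ) + 1) * Real.log (16 * n / γ) ≤ 2 * ((d : ℝ) + 1) * L := by gcongr
      _ ≤ 4 * d * L := by nlinarith
  have h5 : h * γ ≤ 4 * d * L :=
    h2.trans (max_le (by nlinarith) (max_le (by positivity) h4))
  nlinarith

/-! ### Half-spaces on the moment curve. -/

/-- The moment curve `t ↦ (t, t², …, t^d)`. -/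
def momentCurve (d : ℕ) (t : ℝ) : EuclideanSpace ℝ (Fin d) :=
  WithLp.toLp 2 fun j => t ^ ((j : ℕ) + 1)

/-- Affine functionals pull back along the curve to polynomials of degree at most d: the
coefficients above the constant form the normal vector. -/
theorem exists_linearSeparator_of_polynomial {d : ℕ} (p : Polynomial ℝ) (hp : p.natDegree ≤ d) :
    ∃ f ∈ linearSeparators d, ∀ t : ℝ, f (momentCurve d t) = if 0 ≤ p.eval t then 1 else -1 := by
  refine ⟨fun x => if 0 ≤ inner ℝ (WithLp.toLp 2 fun j : Fin d => p.coeff (j + 1)) x + p.coeff 0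
    then 1 else -1, ⟨_, _, fun x => rfl⟩, fun t => ?_⟩
  have : inner ℝ (WithLp.toLp 2 fun j : Fin d => p.coeff (j + 1)) (momentCurve d t) + p.coeff 0
      = p.eval t := by
    rw [Polynomial.eval_eq_sum_range' (Nat.lt_succ_of_le hp), Finset.sum_range_succ',
      ← Fin.sum_univ_eq_sum_range (fun i => p.coeff (i + 1) * t ^ (i + 1))]
    simp [momentCurve, PiLp.inner_apply, mul_comm]
  simp only [this]

/-- Any set of at most `d / 2` points of the moment curve is cut off by a half-space. -/
theorem exists_linearSeparator_of_card_le {d : ℕ} (A : Finset ℕ) (hA : 2 * A.card ≤ d) :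
    ∃ f ∈ linearSeparators d, ∀ t : ℕ, f (momentCurve d t) = if t ∈ A then 1 else -1 := by
  -- Minus a square is nonnegative exactly at its zeros; squaring doubles the degree, whence 2|A| ≤
  -- d.
  obtain ⟨f, hf, hfp⟩ := exists_linearSeparator_of_polynomial (d := d)
    (-(∏ a ∈ A, (Polynomial.X - Polynomial.C (a : ℝ))) ^ 2) (by
      rw [Polynomial.natDegree_neg, Polynomial.natDegree_pow, Polynomial.natDegree_prod_of_monic _ _
        fun a _ => Polynomial.monic_X_sub_C _]
      simp only [Polynomial.natDegree_X_sub_C, Finset.sum_const, smul_eq_mul, mul_one]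
      exact hA)
  refine ⟨f, hf, fun t => ?_⟩
  rw [hfp]
  congr 1
  simp only [Polynomial.eval_neg, Polynomial.eval_pow, Polynomial.eval_prod, Polynomial.eval_sub,
    Polynomial.eval_X, Polynomial.eval_C, eq_iff_iff]
  have hsq := sq_nonneg (∏ a ∈ A, ((t : ℝ) - a))
  rw [Left.nonneg_neg_iff]
  constructor
  · intro h
    have h0 := pow_eq_zero_iff (two_ne_zero) |>.1 (le_antisymm h hsq)
    obtain ⟨a, ha, hta⟩ := Finset.prod_eq_zero_iff.1 h0
    rwa [Nat.cast_injective (sub_eq_zero.1 hta)]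
  · intro h
    rw [Finset.prod_eq_zero h (sub_self _)]
    simp

/-! ### Codes of large relative distance. -/

/-- A Gilbert–Varshamov code of relative distance `1 / 2`. -/
theorem exists_code (s q : ℕ) :
    ∃ C : Finset (Fin s → Fin q), (∀ c ∈ C, ∀ c' ∈ C, c ≠ c' → s < 2 * hammingDist c c') ∧
      q ^ s ≤ C.card * (2 ^ s * q ^ (s / 2)) := by
  classical
  obtain ⟨C, hC⟩ := (Set.toFinite {C : Finset (Fin s → Fin q) |
    ∀ c ∈ C, ∀ c' ∈ C, c ≠ c' → s < 2 * hammingDist c c'}).exists_maximal ⟨∅, by simp⟩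
  refine ⟨C, hC.prop, ?_⟩
  -- A ball is counted by choosing the coordinates that change (at most 2 ^ s ways), then their
  -- values. Balls around a maximal code cover the space.
  have hball : ∀ c : Fin s → Fin q,
      (Finset.univ.filter fun g => 2 * hammingDist c g ≤ s).card ≤ 2 ^ s * q ^ (s / 2) := by
    intro c
    have hsub : (Finset.univ.filter fun g : Fin s → Fin q => 2 * hammingDist c g ≤ s) ⊆
        ((Finset.univ : Finset (Fin s)).powerset.filter fun T => T.card ≤ s / 2).biUnion
          fun T => Fintype.piFinset fun i => if i ∈ T then Finset.univ else {c i} := by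
      intro g hg
      have hg' := (Finset.mem_filter.1 hg).2
      refine Finset.mem_biUnion.2 ⟨Finset.univ.filter fun i => c i ≠ g i, ?_, ?_⟩
      · refine Finset.mem_filter.2 ⟨by simp, ?_⟩
        have : (Finset.univ.filter fun i => c i ≠ g i).card = hammingDist c g := rfl
        omega
      · rw [Fintype.mem_piFinset]
        intro i
        by_cases hi : c i = g i <;> simp [hi]
    refine (Finset.card_le_card hsub).trans (Finset.card_biUnion_le.trans ?_)
    have h1 : ∀ T ∈ (Finset.univ : Finset (Fin s)).powerset.filter fun T => T.card ≤ s / 2,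
        (Fintype.piFinset fun i => if i ∈ T then Finset.univ else {c i}).card ≤ q ^ (s / 2) := by
      intro T hT
      have hT' := (Finset.mem_filter.1 hT).2
      rw [Fintype.card_piFinset]
      have : ∀ i, (if i ∈ T then (Finset.univ : Finset (Fin q)) else {c i}).card
          = if i ∈ T then q else 1 := by
        intro i; split_ifs <;> simp
      simp only [this]
      rw [Finset.prod_ite_mem, Finset.univ_inter, Finset.prod_const]
      rcases Nat.eq_zero_or_pos q with rfl | hq
      · rcases Nat.eq_zero_or_pos s with rfl | hs
        · simp [Finset.eq_empty_of_isEmpty T]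
        · exact (c ⟨0, hs⟩).elim0
      · exact Nat.pow_le_pow_right hq hT'
    refine (Finset.sum_le_card_nsmul _ _ _ h1).trans ?_
    rw [smul_eq_mul]
    refine Nat.mul_le_mul_right _ ((Finset.card_filter_le _ _).trans ?_)
    simp
  have hcover : (Finset.univ : Finset (Fin s → Fin q)) ⊆
      C.biUnion fun c => Finset.univ.filter fun g => 2 * hammingDist c g ≤ s := by
    intro g _
    by_contra hg
    simp only [Finset.mem_biUnion, Finset.mem_filter, Finset.mem_univ, true_and, not_exists,
      not_and, not_le] at hg
    have hins : ∀ c ∈ insert g C, ∀ c' ∈ insert g C, c ≠ c' → s < 2 * hammingDist c c' := by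
      intro c hc c' hc' hne
      rcases Finset.mem_insert.1 hc with rfl | h1 <;> rcases Finset.mem_insert.1 hc' with rfl | h2
      · exact absurd rfl hne
      · rw [hammingDist_comm]; exact hg _ h2
      · exact hg _ h1
      · exact hC.prop _ h1 _ h2 hne
    have := hC.le_of_ge hins (Finset.subset_insert _ _) (Finset.mem_insert_self g C)
    have h0 := hg g this
    simp at h0
  have := (Finset.card_le_card hcover).trans
    (Finset.card_biUnion_le.trans (Finset.sum_le_card_nsmul _ _ _ fun c _ => hball c))
  simpa using this

/-- For q ≥ 16 the factor 2 ^ s is at most q ^ (s/4), which leaves q ^ (s - s/4 - s/2). -/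
theorem exists_code_log_card {s q : ℕ} (hq : 16 ≤ q) :
    ∃ C : Finset (Fin s → Fin q), (∀ c ∈ C, ∀ c' ∈ C, c ≠ c' → s < 2 * hammingDist c c') ∧
      (s : ℝ) / 4 * Real.log q ≤ Real.log C.card := by
  obtain ⟨C, hsep, hcard⟩ := exists_code s q
  refine ⟨C, hsep, ?_⟩
  have hq0 : (16 : ℝ) ≤ q := by exact_mod_cast hq
  have hCpos : (0 : ℝ) < C.card := by
    rcases Nat.eq_zero_or_pos C.card with h0 | h0
    · rw [h0, zero_mul] at hcard
      have : 0 < q ^ s := by positivity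
      omega
    · exact_mod_cast h0
  have h1 : (q : ℝ) ^ s ≤ C.card * (2 ^ s * q ^ (s / 2)) := by exact_mod_cast hcard
  have h2 := Real.log_le_log (by positivity) h1
  rw [Real.log_mul (by positivity) (by positivity), Real.log_mul (by positivity) (by positivity),
    Real.log_pow, Real.log_pow, Real.log_pow] at h2
  have h3 : Real.log 2 ≤ Real.log q / 4 := by
    have h4 : Real.log ((2 : ℝ) ^ 4) ≤ Real.log q := 
      Real.log_le_log (by norm_num) (by linarith)
    rw [Real.log_pow] at h4
    push_cast at h4
    linarith
  have h5 : ((s / 2 : ℕ) : ℝ) ≤ s / 2 := Nat.cast_div_le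
  have h6 : 0 ≤ Real.log q := Real.log_nonneg (by linarith)
  have h7 : (0 : ℝ) ≤ s := Nat.cast_nonneg s
  have h8 := mul_le_mul_of_nonneg_right h5 h6
  have h9 := mul_le_mul_of_nonneg_left h3 h7
  linarith

/-! ### From codes to packings of half-spaces. -/

/-- The graph of `c`, as a set of natural numbers. -/
def codeSet {s q : ℕ} (c : Fin s → Fin q) : Finset ℕ :=
  Finset.univ.image fun j : Fin s => (j : ℕ) * q + c j

theorem card_codeSet_le {s q : ℕ} (c : Fin s → Fin q) : (codeSet c).card ≤ s :=
  Finset.card_image_le.trans (by simp)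

theorem mul_add_inj_of_lt {q a b r t : ℕ} (hr : r < q) (ht : t < q) (h : a * q + r = b * q + t) :
    a = b ∧ r = t := by
  have hq : 0 < q := by omega
  have h1 : a = b := by
    have := congrArg (· / q) h
    simpa [Nat.add_div_of_dvd_right, Nat.mul_div_cancel _ hq, Nat.div_eq_of_lt hr,
      Nat.div_eq_of_lt ht] using this
  subst h1
  exact ⟨rfl, by omega⟩

theorem mem_codeSet_iff {s q : ℕ} (c : Fin s → Fin q) (j : Fin s) (v : Fin q) :
    (j : ℕ) * q + v ∈ codeSet c ↔ c j = v := by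
  simp only [codeSet, Finset.mem_image, Finset.mem_univ, true_and]
  constructor
  · rintro ⟨i, hi⟩
    obtain ⟨h1, h2⟩ := mul_add_inj_of_lt (c i).2 v.2 hi
    obtain rfl := Fin.ext h1
    exact Fin.ext h2
  · rintro rfl
    exact ⟨j, rfl⟩

theorem card_filter_div_mem_le {n k : ℕ} (hk : 0 < k) (A : Finset ℕ) :
    (Finset.univ.filter fun i : Fin n => (i : ℕ) / k ∈ A).card ≤ A.card * k := by
  have hprod : A.card * k = (A ×ˢ Finset.range k).card := by
    rw [Finset.card_product, Finset.card_range]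
  rw [hprod]
  refine Finset.card_le_card_of_injOn (fun i => ((i : ℕ) / k, (i : ℕ) % k)) ?_ ?_
  · intro i hi
    have := (Finset.mem_filter.1 hi).2
    simp [this, Nat.mod_lt _ hk]
  · intro i _ j _ hij
    simp only [Prod.mk.injEq] at hij
    apply Fin.ext
    rw [← Nat.div_add_mod (i : ℕ) k, ← Nat.div_add_mod (j : ℕ) k, hij.1, hij.2]

/-- Each coordinate where the words differ gives a node on the graph of `c` only, carrying k sample
indices since s·q·k ≤ n. This one-sided count is enough. -/
theorem hammingDist_mul_le_card {s q k n : ℕ} (hn : s * q * k ≤ n) (c c' : Fin s → Fin q) :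
    hammingDist c c' * k ≤ (Finset.univ.filter fun i : Fin n =>
      (i : ℕ) / k ∈ codeSet c ∧ (i : ℕ) / k ∉ codeSet c').card := by
  have hlt : ∀ (j : Fin s) (v : Fin q) (r : Fin k), ((j : ℕ) * q + v) * k + r < n := by
    intro j v r
    have h1 : (j : ℕ) * q + v + 1 ≤ s * q := by
      have := Nat.mul_le_mul_right q (Nat.succ_le_of_lt j.2)
      have := v.2
      rw [Nat.succ_mul] at *
      omega
    have h2 := Nat.mul_le_mul_right k h1
    have := r.2
    rw [Nat.succ_mul] at h2
    omega
  have hcard : hammingDist c c' * k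
      = ((Finset.univ.filter fun j => c j ≠ c' j) ×ˢ (Finset.univ : Finset (Fin k))).card := by
    rw [Finset.card_product, Finset.card_univ, Fintype.card_fin]; rfl
  rw [hcard]
  refine Finset.card_le_card_of_injOn (fun p => ⟨_, hlt p.1 (c p.1) p.2⟩) ?_ ?_
  · rintro ⟨j, r⟩ hp
    have hj : c j ≠ c' j := by simpa using hp
    have hk : 0 < k := r.pos
    have hdiv : (((j : ℕ) * q + c j) * k + r) / k = (j : ℕ) * q + c j := by
      rw [mul_comm _ k, Nat.mul_add_div hk, Nat.div_eq_of_lt r.2, add_zero]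
    simp only [Finset.coe_filter, Finset.mem_univ, true_and, Set.mem_ofPred_eq, hdiv,
      mem_codeSet_iff]
    exact fun h => hj h.symm
  · rintro ⟨j, r⟩ _ ⟨j', r'⟩ _ h
    simp only [Fin.mk.injEq] at h
    obtain ⟨h1, h2⟩ := mul_add_inj_of_lt r.2 r'.2 h
    obtain ⟨h3, -⟩ := mul_add_inj_of_lt (c j).2 (c j').2 h1
    rw [Fin.ext h3, Fin.ext h2]

theorem card_le_localPackingNumber {d n s q k : ℕ} {γ h : ℝ} (hsd : 2 * s ≤ d)
    (hn : s * q * k ≤ n) (hk : 0 < k) (hh : 0 < h) (hh1 : h ≤ 1) (hγ : γ ≤ h * (s * k))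
    (C : Finset (Fin s → Fin q))
    (hC : ∀ c ∈ C, ∀ c' ∈ C, c ≠ c' → s < 2 * hammingDist c c') :
    (C.card : ℕ∞) ≤ localPackingNumber (linearSeparators d) γ n h := by
  classical
  -- Consecutive blocks of k indices share a node.
  set x : Fin n → EuclideanSpace ℝ (Fin d) := fun i => momentCurve d (((i : ℕ) / k : ℕ) : ℝ) with hx
  obtain ⟨f, hf, hfx⟩ := exists_linearSeparator_of_card_le (d := d) ∅ (by simp)
  choose g hg hgx using fun c : Fin s → Fin q =>
    exists_linearSeparator_of_card_le (d := d) (codeSet c)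
      ((Nat.mul_le_mul_left 2 (card_codeSet_le c)).trans hsd)
  have hfi : ∀ i, f (x i) = -1 := fun i => by rw [hx, hfx]; simp
  have hgi : ∀ c i, g c (x i) = if (i : ℕ) / k ∈ codeSet c then 1 else -1 := fun c i => by
    rw [hx, hgx]
  have hne : (1 : ℤˣ) ≠ -1 := by decide
  have hball : ∀ c, hammingDist (f ∘ x) (g c ∘ x) ≤ s * k := by
    intro c
    refine le_trans (Finset.card_le_card fun i hi => ?_)
      ((card_filter_div_mem_le (n := n) hk (codeSet c)).trans
        (Nat.mul_le_mul_right k (card_codeSet_le c)))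
    have hi' := (Finset.mem_filter.1 hi).2
    refine Finset.mem_filter.2 ⟨Finset.mem_univ _, ?_⟩
    by_contra hmem
    simp [hfi, hgi, hmem] at hi'
  have hsep : ∀ c c', hammingDist c c' * k ≤ hammingDist (g c ∘ x) (g c' ∘ x) := by
    intro c c'
    refine (hammingDist_mul_le_card hn c c').trans (Finset.card_le_card fun i hi => ?_)
    have hi' := (Finset.mem_filter.1 hi).2
    refine Finset.mem_filter.2 ⟨Finset.mem_univ _, ?_⟩
    simp [hgi, hi'.1, hi'.2, hne]
  -- Chosen so that ε/h = sk is the ball radius; then ε/2 ≤ sk/2 because h ≤ 1.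
  set ε : ℝ≥0 := ⟨h * (s * k), by positivity⟩ with hε
  have hεr : (ε : ℝ) = h * (s * k) := rfl
  have hlt : ∀ c ∈ C, ∀ c' ∈ C, c ≠ c' →
      (ε : ℝ) / 2 < hammingDist (g c ∘ x) (g c' ∘ x) := by
    intro c hc c' hc' hcc
    have h1 : (s : ℝ) < 2 * hammingDist c c' := by exact_mod_cast hC c hc c' hc' hcc
    have h2 : (hammingDist c c' : ℝ) * k ≤ hammingDist (g c ∘ x) (g c' ∘ x) := by
      exact_mod_cast hsep c c'
    have hk' : (0 : ℝ) < k := by exact_mod_cast hk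
    have h3 := mul_lt_mul_of_pos_right h1 hk'
    have h4 : h * ((s : ℝ) * k) ≤ s * k := mul_le_of_le_one_left (by positivity) hh1
    rw [hεr]
    linarith
  set P : (Fin s → Fin q) → Hamming fun _ : Fin n => ℤˣ := fun c => Hamming.toHamming (g c ∘ x)
  have hinj : Set.InjOn P C := by
    intro c hc c' hc' heq
    by_contra hcc
    have h1 := hlt c hc c' hc' hcc
    rw [Hamming.toHamming.injective heq, hammingDist_self, Nat.cast_zero] at h1
    linarith [ε.2]
  rw [← Set.encard_coe_eq_coe_finsetCard, ← hinj.encard_image]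
  have hsub : P '' C ⊆ sampleProjection (empiricalBall (linearSeparators d) f (ε / h) x) x := by
    rintro _ ⟨c, -, rfl⟩
    refine ⟨g c, ⟨hg c, ?_⟩, rfl⟩
    rw [hεr, mul_div_cancel_left₀ _ hh.ne']
    exact_mod_cast hball c
  have hsepC : Metric.IsSeparated ((ε / 2 : ℝ≥0) : ENNReal) (P '' C) := by
    rintro _ ⟨c, hc, rfl⟩ _ ⟨c', hc', rfl⟩ hcc
    have h1 := hlt c hc c' hc' fun h => hcc (by rw [h])
    have h2 : ε / 2 < (hammingDist (g c ∘ x) (g c' ∘ x) : ℝ≥0) := by exact_mod_cast h1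
    rw [hamming_edist_eq]
    exact_mod_cast h2
  have hpack : (P '' C).encard ≤ Metric.packingNumber (ε / 2)
      (sampleProjection (empiricalBall (linearSeparators d) f (ε / h) x) x) :=
    le_iSup_of_le (P '' C) (le_iSup_of_le hsub (le_iSup_of_le hsepC le_rfl))
  exact hpack.trans (le_iSup_of_le x (le_iSup_of_le f (le_iSup_of_le hf
    (le_iSup_of_le ε (le_iSup_of_le hγ le_rfl)))))

/-! ### The lower bound. -/

theorem truncLog_le_sqrt {u : ℝ} (hu : 1 ≤ u) : truncLog u ≤ Real.sqrt u := by
  have h1 : 1 ≤ Real.sqrt u := Real.one_le_sqrt.2 hu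
  have h0 : 0 < Real.sqrt u := by linarith
  rw [truncLog, Real.log_le_iff_le_exp (lt_max_of_lt_right (Real.exp_pos 1))]
  refine max_le ?_ (Real.exp_le_exp.2 h1)
  calc u = Real.sqrt u ^ 2 := (Real.sq_sqrt (by linarith)).symm
    _ ≤ Real.exp (Real.sqrt u) := ?_
  have h2 := Real.quadratic_le_exp_of_nonneg (half_pos h0).le
  have h3 : Real.exp (Real.sqrt u) = Real.exp (Real.sqrt u / 2) ^ 2 := by
    rw [← Real.exp_nat_mul]; congr 1; push_cast; ring
  rw [h3]
  refine pow_le_pow_left₀ h0.le ?_ 2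
  nlinarith [sq_nonneg (Real.sqrt u / 2 - 1)]

/-- At scales up to `d * truncLog (n * h ^ 2 / d) / (256 * h)` the local entropy is large. -/
theorem le_truncLog_localPackingNumber {d n : ℕ} {h γ : ℝ} (hd : 2 ≤ d) (hh : 0 < h) (hh1 : h ≤ 1)
    (hu : (d : ℝ) < n * h ^ 2)
    (hγ : h * γ ≤ d * truncLog ((n : ℝ) * h ^ 2 / d) / 256) :
    h * γ ≤ truncLog ((localPackingNumber (linearSeparators d) γ n h).toNat : ℝ) := by
  have hd0 : (2 : ℝ) ≤ d := by exact_mod_cast hd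
  set u : ℝ := (n : ℝ) * h ^ 2 / d with hudef
  have hu1 : 1 < u := by rw [hudef, one_lt_div (by linarith)]; exact hu
  have hud : u * d = n * h ^ 2 := by rw [hudef]; field_simp
  have hh2 : h ^ 2 ≤ 1 := pow_le_one₀ hh.le hh1
  have hudn : u * d ≤ n := by rw [hud]; exact mul_le_of_le_one_right (Nat.cast_nonneg n) hh2
  have hL1 := one_le_truncLog u
  have hLs := truncLog_le_sqrt hu1.le
  by_cases htriv : h * γ ≤ 1
  · exact htriv.trans (one_le_truncLog _)
  set w := Real.sqrt u with hw
  have hw1 : 1 < w := by rw [hw]; exact Real.lt_sqrt_of_sq_lt (by linarith)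
  have hww : w ^ 2 = u := Real.sq_sqrt (by linarith)
  -- Taking q of order √u makes log q comparable to log u, while nh²/q stays of order at least d√u,
  -- which dominates d log u.
  set q : ℕ := ⌊16 * w⌋₊ with hq
  have hq1 : (q : ℝ) ≤ 16 * w := Nat.floor_le (by linarith)
  have hq16 : 16 ≤ q := Nat.le_floor (by push_cast; linarith)
  have hq2 : w ≤ q := by
    have := Nat.lt_floor_add_one (16 * w)
    rw [← hq] at this
    linarith
  set s : ℕ := max 1 (d / 16) with hs
  have hs1 : 1 ≤ s := le_max_left _ _
  have hsd : 2 * s ≤ d := by omega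
  have hds : (d : ℝ) ≤ 32 * s := by exact_mod_cast (by omega : d ≤ 32 * s)
  have hsqn : (s : ℝ) * q ≤ n := by
    rcases Nat.lt_or_ge d 16 with hd16 | hd16
    · have hs' : s = 1 := by omega
      rw [hs', Nat.cast_one, one_mul]
      have hd16' : (d : ℝ) ≤ 16 := by exact_mod_cast hd16.le
      -- If w < 8 and d ≤ 16, then hγ ≤ dw/256 ≤ 1, the case already settled. Now 16w ≤ 2w² ≤ du ≤
      -- n.
      have hw8 : 8 ≤ w := by
        by_contra! hlt
        have : h * γ ≤ 1 := by nlinarith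
        exact htriv this
      nlinarith
    · have hs' : (16 * s : ℝ) ≤ d := by exact_mod_cast (by omega : 16 * s ≤ d)
      have : (s : ℝ) * q ≤ s * (16 * w) := by gcongr
      nlinarith
  have hsqn' : s * q ≤ n := by exact_mod_cast hsqn
  have hsq0 : 0 < s * q := by positivity
  set k : ℕ := n / (s * q) with hk
  have hk0 : 0 < k := Nat.div_pos hsqn' hsq0
  have hkn : s * q * k ≤ n := Nat.mul_div_le n (s * q)
  have hkn2 : (n : ℝ) ≤ 2 * (s * q * k) := by
    have h1 : n < s * q * (k + 1) := by
      rw [hk]; exact Nat.lt_mul_div_succ n hsq0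
    have h2 : s * q ≤ s * q * k := Nat.le_mul_of_pos_right _ hk0
    have h3 : n ≤ 2 * (s * q * k) := by rw [mul_add, mul_one] at h1; omega
    exact_mod_cast h3
  have hγε : γ ≤ h * (s * k) := by
    refine le_of_mul_le_mul_left (hγ.trans ?_) hh
    have hq0 : (0 : ℝ) < q := by linarith
    have h1 : (d : ℝ) * u ≤ h ^ 2 * (s * k) * (32 * w) := by
      calc (d : ℝ) * u = n * h ^ 2 := by rw [mul_comm, hud]
        _ ≤ 2 * (s * q * k) * h ^ 2 := by gcongr
        _ = h ^ 2 * (s * k) * (2 * q) := by ring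
        _ ≤ h ^ 2 * (s * k) * (32 * w) :=
          mul_le_mul_of_nonneg_left (by linarith) (by positivity)
    have h2 : (d : ℝ) * w ≤ h ^ 2 * (s * k) * 32 := by
      refine le_of_mul_le_mul_right ?_ (show 0 < w by linarith)
      calc (d : ℝ) * w * w = d * u := by rw [← hww]; ring
        _ ≤ _ := h1.trans_eq (by ring)
    have h3 : (d : ℝ) * truncLog u ≤ d * w := by gcongr
    have h4 : 0 ≤ h ^ 2 * ((s : ℝ) * k) := by positivity
    calc (d : ℝ) * truncLog u / 256 ≤ h ^ 2 * (s * k) := by linarith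
      _ = h * (h * (s * k)) := by ring
  obtain ⟨C, hC, hlog⟩ := exists_code_log_card (s := s) hq16
  have hpack := card_le_localPackingNumber hsd hkn hk0 hh hh1 hγε C hC
  have htop : localPackingNumber (linearSeparators d) γ n h ≠ ⊤ :=
    ne_top_of_le_ne_top (ENat.natCast_ne_top _) (localPackingNumber_le _ γ n h)
  have hcard : C.card ≤ (localPackingNumber (linearSeparators d) γ n h).toNat := by
    rw [← ENat.natCast_toNat htop] at hpack
    exact_mod_cast hpack
  have hLq : truncLog u ≤ 2 * Real.log q := by
    have hq0 : (16 : ℝ) ≤ q := by exact_mod_cast hq16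
    have h1 : Real.log ((q : ℝ) ^ 2) = 2 * Real.log q := by rw [Real.log_pow]; norm_num
    rw [← h1]
    refine Real.log_le_log (lt_max_of_lt_right (Real.exp_pos 1)) (max_le ?_ ?_)
    · rw [← hww]; exact pow_le_pow_left₀ (by linarith) hq2 2
    · nlinarith [Real.exp_one_lt_d9]
  have hlogq : 0 ≤ Real.log q := by linarith
  -- The constant 256 is 4 · 32 · 2, from the code rate, d ≤ 32s and log u ≤ 2 log q.
  have h1 : h * γ ≤ Real.log C.card := by
    refine hγ.trans (le_trans ?_ hlog)
    have h2 : (d : ℝ) * truncLog u ≤ (32 * s) * (2 * Real.log q) := by gcongr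
    linarith
  have hCpos : 0 < C.card := by
    rcases Nat.eq_zero_or_pos C.card with h0 | h0
    · rw [h0, Nat.cast_zero, Real.log_zero] at h1
      linarith
    · exact h0
  refine h1.trans ((log_le_truncLog (by exact_mod_cast hCpos)).trans (truncLog_mono ?_))
  exact_mod_cast hcard

theorem le_gammaLoc_linearSeparators {d n : ℕ} {h : ℝ} (hd : 2 ≤ d) (hh : 0 < h) (hh1 : h ≤ 1)
    (hu : (d : ℝ) < n * h ^ 2) :
    1 / 512 * ((d : ℝ) * truncLog ((n : ℝ) * h ^ 2 / (d : ℝ)) / h)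
      ≤ (gammaLoc (linearSeparators d) h h n : ℝ) := by
  set y : ℝ := (d : ℝ) * truncLog ((n : ℝ) * h ^ 2 / (d : ℝ)) / h / 256 with hy
  have hL1 := one_le_truncLog ((n : ℝ) * h ^ 2 / (d : ℝ))
  have hy0 : 0 ≤ y := by positivity
  have hyh : h * y = d * truncLog ((n : ℝ) * h ^ 2 / (d : ℝ)) / 256 := by rw [hy]; field_simp
  -- The value 1 always qualifies, so y < ⌊y⌋ + 1 is at most twice the fixed point; hence 512
  -- instead of 256.
  have h1 : (1 : ℕ) ≤ gammaLoc (linearSeparators d) h h n := by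
    refine le_gammaLoc _ hh ?_
    rw [Nat.cast_one, mul_one]
    exact hh1.trans (one_le_truncLog _)
  have h2 : ⌊y⌋₊ ≤ gammaLoc (linearSeparators d) h h n := by
    refine le_gammaLoc _ hh (le_truncLog_localPackingNumber hd hh hh1 hu ?_)
    rw [← hyh]
    exact mul_le_mul_of_nonneg_left (Nat.floor_le hy0) hh.le
  have h1' : (1 : ℝ) ≤ gammaLoc (linearSeparators d) h h n := by exact_mod_cast h1
  have h2' : (⌊y⌋₊ : ℝ) ≤ gammaLoc (linearSeparators d) h h n := by exact_mod_cast h2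
  have h3 := Nat.lt_floor_add_one y
  have h4 : 1 / 512 * ((d : ℝ) * truncLog ((n : ℝ) * h ^ 2 / (d : ℝ)) / h) = y / 2 := by
    rw [hy]; ring
  rw [h4]
  linarith

theorem proposition7p1 :
    (∃ c C : ℝ, 0 < c ∧ 0 < C ∧
      ∀ (d n : ℕ) (h : ℝ), 2 ≤ d → 1 ≤ n → h ≤ 1 → Real.sqrt ((d : ℝ) / (n : ℝ)) < h →
        c * ((d : ℝ) * truncLog ((n : ℝ) * h ^ 2 / (d : ℝ)) / h)
            ≤ (gammaLoc (linearSeparators d) h h n : ℝ) ∧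
          (gammaLoc (linearSeparators d) h h n : ℝ)
            ≤ C * ((d : ℝ) * truncLog ((n : ℝ) * h / (d : ℝ)) / h)) ∧
    (∃ c C : ℝ, 0 < c ∧ 0 < C ∧
      ∀ d n : ℕ, 2 ≤ d → d < n →
        c * ((d : ℝ) * truncLog ((n : ℝ) / (d : ℝ)))
            ≤ (gammaLoc (linearSeparators d) 1 1 n : ℝ) ∧
          (gammaLoc (linearSeparators d) 1 1 n : ℝ)
            ≤ C * ((d : ℝ) * truncLog ((n : ℝ) / (d : ℝ)))) := by
  refine ⟨⟨1 / 512, 16, by norm_num, by norm_num, fun d n h hd hn hh1 hsqrt => ?_⟩,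
    ⟨1 / 512, 16, by norm_num, by norm_num, fun d n hd hdn => ?_⟩⟩
  · have hh : 0 < h := (Real.sqrt_nonneg _).trans_lt hsqrt
    have hn0 : (0 : ℝ) < n := by exact_mod_cast hn
    have hu : (d : ℝ) < n * h ^ 2 := by
      have := (Real.sqrt_lt' hh).1 hsqrt
      rwa [div_lt_iff₀ hn0, mul_comm] at this
    exact ⟨le_gammaLoc_linearSeparators hd hh hh1 hu, gammaLoc_linearSeparators_le hd hn hh⟩
  · have hu : (d : ℝ) < n * (1 : ℝ) ^ 2 := by
      rw [one_pow, mul_one]; exact_mod_cast hdn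
    have h1 := le_gammaLoc_linearSeparators hd one_pos le_rfl hu
    have h2 := gammaLoc_linearSeparators_le (n := n) hd (by omega) one_pos
    rw [one_pow, mul_one, div_one] at h1
    rw [mul_one, div_one] at h2
    exact ⟨h1, h2⟩
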